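/- Let $M$ be a free Abelian group of finite rank, $V=M\otimes\mathbb R$, and call the elements of $M\subset V$ integer points; for a linear subspace $L\subset V$ put $L(\mathbb Z)=L\cap M$. A subspace is rational if it is spanned by integer points. A subgroup of $M$ is pure if it equals $L(\mathbb Z)$ for some rational subspace $L$; two rational subspaces $L,L'$ are mutually pure if $L(\mathbb Z)+L'(\mathbb Z)$ is a pure subgroup of $M$. A polyhedron in $V$ is the solution set of a finite system of linear inequalities $p(v)\le a$; it is rational if the system can be chosen with $p\in M^*=\mathrm{Hom}(M,\mathbb Z)$ and $a\in\mathbb Z$, and integer if it is rational and each of its non-empty faces contains an integer point. A class of integer polyhedra is a class of discrete convexity (DC-class) if it is stable under translations by elements of $M$, under the reflection $P\mapsto -P$ and under taking non-empty faces, and if the intersection of any two of its members is an integer polyhedron (not necessarily in the class). Theorem 2. Let $\mathcal U$ be a collection of rational linear subspaces of $V$, and let $\mathcal Ph(\mathcal U,\mathbb Z)$ be the class of integer polyhedra $P\subset V$ such that for every non-empty face $F$ of $P$ the tangent space $\mathbb R(F-F)$ belongs to $\mathcal U$. Then $\mathcal Ph(\mathcal U,\mathbb Z)$ is a DC-class if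 and only if $\mathcal U$ is a pure system, i.e. any two subspaces in $\mathcal U$ are mutually pure. -/

import Mathlib

open scoped TensorProduct Pointwise

namespace DiscreteConvexity

noncomputable section

/-- The ambient real vector space `V = ℝ ⊗ M` of an abelian group `M`. -/
abbrev Ambient (M : Type*) [AddCommGroup M] : Type _ := ℝ ⊗[ℤ] M

/-- The canonical map `M → V`, `m ↦ 1 ⊗ m`. -/
def incl (M : Type*) [AddCommGroup M] : M →+ Ambient M :=
  (TensorProduct.mk ℤ ℝ M 1).toAddMonoidHom

/-- A point of `V` is integer if it belongs to (the image of) `M`. -/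
def IsIntegerPoint {M : Type*} [AddCommGroup M] (v : Ambient M) : Prop :=
  ∃ m : M, incl M m = v

/-- The real linear functional on `V` induced by `p ∈ M* = Hom(M, ℤ)`: it maps `r ⊗ m` to
`r * p m`. -/
def extendFunctional {M : Type*} [AddCommGroup M] (p : M →ₗ[ℤ] ℤ) : Ambient M →ₗ[ℝ] ℝ :=
  (TensorProduct.AlgebraTensorModule.rid ℤ ℝ ℝ).toLinearMap ∘ₗ p.baseChange ℝ

/-! ### Subspaces and purity -/

/-- A real subspace of `V` is rational if it is spanned by its integer points. -/
def IsRationalSubspace {M : Type*} [AddCommGroup M] (L : Submodule ℝ (Ambient M)) : Prop :=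
  Submodule.span ℝ {v | v ∈ L ∧ IsIntegerPoint v} = L

/-- `L(ℤ) = L ∩ M`, as a subgroup of `M`. -/
def integerPoints {M : Type*} [AddCommGroup M] (L : Submodule ℝ (Ambient M)) : AddSubgroup M :=
  L.toAddSubgroup.comap (incl M)

/-- A subgroup of `M` is pure if it is the group of all integer points of a rational subspace. -/
def IsPureSubgroup {M : Type*} [AddCommGroup M] (S : AddSubgroup M) : Prop :=
  ∃ L : Submodule ℝ (Ambient M), IsRationalSubspace L ∧ integerPoints L = S

/-- `L` and `L'` are mutually pure if `L(ℤ) + L'(ℤ)` is a pure subgroup of `M`. -/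
def MutuallyPure {M : Type*} [AddCommGroup M] (L L' : Submodule ℝ (Ambient M)) : Prop :=
  IsPureSubgroup (integerPoints L ⊔ integerPoints L')

/-- A pure system: any two members are mutually pure. -/
def IsPureSystem {M : Type*} [AddCommGroup M] (U : Set (Submodule ℝ (Ambient M))) : Prop :=
  ∀ F ∈ U, ∀ G ∈ U, MutuallyPure F G

/-! ### Polyhedra -/

/-- A polyhedron: the solution set of a finite system of linear inequalities `p v ≤ a`. -/
def IsPolyhedron {M : Type*} [AddCommGroup M] (P : Set (Ambient M)) : Prop :=
  ∃ s : Finset ((Ambient M →ₗ[ℝ] ℝ) × ℝ), P = {v | ∀ c ∈ s, c.1 v ≤ c.2}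

/-- A rational polyhedron: the solution set of a finite system of inequalities `p v ≤ a` with
`p ∈ M*` and `a ∈ ℤ`. -/
def IsRationalPolyhedron {M : Type*} [AddCommGroup M] (P : Set (Ambient M)) : Prop :=
  ∃ s : Finset ((M →ₗ[ℤ] ℤ) × ℤ), P = {v | ∀ c ∈ s, extendFunctional c.1 v ≤ (c.2 : ℝ)}

/-- `F` is a (non-empty) face of `P`: the set of points of `P` at which some linear functional
attains its maximum over `P`. A non-empty `P` is a face of itself (take `p = 0`). -/
def IsFace {M : Type*} [AddCommGroup M] (F P : Set (Ambient M)) : Prop :=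
  F.Nonempty ∧ ∃ p : Ambient M →ₗ[ℝ] ℝ, F = {x | x ∈ P ∧ ∀ y ∈ P, p y ≤ p x}

/-- An integer polyhedron: a rational polyhedron each of whose (non-empty) faces contains an
integer point. -/
def IsIntegerPolyhedron {M : Type*} [AddCommGroup M] (P : Set (Ambient M)) : Prop :=
  IsRationalPolyhedron P ∧ ∀ F, IsFace F P → ∃ v ∈ F, IsIntegerPoint v

/-- The tangent space `Tan(F) = ℝ(F - F)`. -/
def tangentSpace {M : Type*} [AddCommGroup M] (F : Set (Ambient M)) : Submodule ℝ (Ambient M) :=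
  Submodule.span ℝ (F - F)

/-- The class of `U`-polyhedra: the polyhedra all of whose faces have tangent space in `U`. -/
def Ph {M : Type*} [AddCommGroup M] (U : Set (Submodule ℝ (Ambient M))) :
    Set (Set (Ambient M)) :=
  {P | IsPolyhedron P ∧ ∀ F, IsFace F P → tangentSpace F ∈ U}

/-- The class of integer `U`-polyhedra. -/
def PhInt {M : Type*} [AddCommGroup M] (U : Set (Submodule ℝ (Ambient M))) :
    Set (Set (Ambient M)) :=
  {P | P ∈ Ph U ∧ IsIntegerPolyhedron P}

/-! ### Classes of discrete convexity -/

/-- An ample class of integer polyhedra: it is stable under integer translations, reflection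
and taking faces. -/
structure IsAmple {M : Type*} [AddCommGroup M] (C : Set (Set (Ambient M))) : Prop where
  integer : ∀ P ∈ C, IsIntegerPolyhedron P
  translate : ∀ P ∈ C, ∀ m : M, (fun v => v + incl M m) '' P ∈ C
  reflect : ∀ P ∈ C, -P ∈ C
  face : ∀ P ∈ C, ∀ F, IsFace F P → F ∈ C

/-- A polyhedral class of discrete convexity: an ample class of integer polyhedra such that the
intersection of any two of its members is an integer polyhedron (not necessarily a member). -/
structure IsDCClass {M : Type*} [AddCommGroup M] (C : Set (Set (Ambient M))) : Prop where
  ample : IsAmple C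
  edmonds : ∀ P ∈ C, ∀ Q ∈ C, IsIntegerPolyhedron (P ∩ Q)

end

end DiscreteConvexity

/-! Necessity: a rational subspace is its own only face, so every `L`, `N` in `U` belong to the
class. If `m` is an integer point of `L + N`, then `L` meets `m + N`; the DC property gives an
integer point `z` there, and `m = z + (m - z)` splits `m` over the integer points of `L` and `N`.

Sufficiency: in a face of `P ∩ Q` choose `x` with a maximal set of tight inequalities; then all
solutions of these equalities lie in the face (`exists_affine_minimal_face`). The inequalities of
`P` tight at `x` cut out a face of `P` with an integer point `m` and tangent space `L ∈ U`, so they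
remain tight on `m + L`; likewise `Q` gives `n + N`. Both affine spaces contain `x`, so `n - m ∈ L +
N`. Purity writes `n - m = l + k` with integer summands, and `m + l = n - k` is an integer point of
the face. -/

namespace DiscreteConvexity

/-! ### Faces of polyhedra as tight subsystems -/

section Systems

variable {M : Type*} [AddCommGroup M]

/-- The solution set of the system `c.1 v ≤ c.2`, `c ∈ s`. -/
def solutionSet (s : Finset ((Ambient M →ₗ[ℝ] ℝ) × ℝ)) : Set (Ambient M) :=
  {v | ∀ c ∈ s, c.1 v ≤ c.2}

/-- The solutions of the system `s` at which the inequalities in `I` are equalities. -/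
def tightSet (s I : Finset ((Ambient M →ₗ[ℝ] ℝ) × ℝ)) : Set (Ambient M) :=
  {v | v ∈ solutionSet s ∧ ∀ c ∈ I, c.1 v = c.2}

/-- The real inequality given by an integer inequality. -/
noncomputable def realConstraint (c : (M →ₗ[ℤ] ℤ) × ℤ) : (Ambient M →ₗ[ℝ] ℝ) × ℝ :=
  (extendFunctional c.1, (c.2 : ℝ))

theorem IsRationalPolyhedron.exists_solutionSet {P : Set (Ambient M)}
    (h : IsRationalPolyhedron P) :
    ∃ t : Finset ((Ambient M →ₗ[ℝ] ℝ) × ℝ),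
      (∀ c ∈ t, ∃ d, realConstraint d = c) ∧ P = solutionSet t := by
  classical
  obtain ⟨s, rfl⟩ := h
  refine ⟨s.image realConstraint, Finset.forall_mem_image.2 fun d _ => ⟨d, rfl⟩, ?_⟩
  ext v
  simp only [solutionSet, Set.mem_ofPred_eq, Finset.forall_mem_image]
  rfl

theorem isRationalPolyhedron_solutionSet {t : Finset ((Ambient M →ₗ[ℝ] ℝ) × ℝ)}
    (h : ∀ c ∈ t, ∃ d : (M →ₗ[ℤ] ℤ) × ℤ, realConstraint d = c) :
    IsRationalPolyhedron (solutionSet t) := by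
  classical
  obtain ⟨u, -, rfl⟩ := Finset.subset_set_image_iff.1
    (show (t : Set ((Ambient M →ₗ[ℝ] ℝ) × ℝ)) ⊆ realConstraint '' Set.univ from
      fun c hc => by simpa only [Set.image_univ, Set.mem_range] using h c hc)
  refine ⟨u, ?_⟩
  ext v
  simp only [solutionSet, Set.mem_ofPred_eq, Finset.forall_mem_image]
  rfl

theorem IsRationalPolyhedron.isPolyhedron {P : Set (Ambient M)}
    (h : IsRationalPolyhedron P) : IsPolyhedron P := by
  obtain ⟨t, -, rfl⟩ := h.exists_solutionSet
  exact ⟨t, rfl⟩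

theorem IsRationalPolyhedron.inter {P Q : Set (Ambient M)}
    (hP : IsRationalPolyhedron P) (hQ : IsRationalPolyhedron Q) :
    IsRationalPolyhedron (P ∩ Q) := by
  classical
  obtain ⟨s, rfl⟩ := hP
  obtain ⟨t, rfl⟩ := hQ
  refine ⟨s ∪ t, ?_⟩
  ext v
  simp only [Set.mem_inter_iff, Set.mem_ofPred_eq, Finset.mem_union, or_imp, forall_and]

theorem extendFunctional_neg (p : M →ₗ[ℤ] ℤ) : extendFunctional (-p) = -extendFunctional p := by
  simp [extendFunctional, LinearMap.baseChange_neg, LinearMap.comp_neg]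

@[simp]
theorem extendFunctional_tmul (p : M →ₗ[ℤ] ℤ) (r : ℝ) (m : M) :
    extendFunctional p (r ⊗ₜ[ℤ] m) = p m * r := by
  simp [extendFunctional]

theorem incl_apply (m : M) : incl M m = (1 : ℝ) ⊗ₜ[ℤ] m := rfl

theorem extendFunctional_incl (p : M →ₗ[ℤ] ℤ) (m : M) :
    extendFunctional p (incl M m) = p m := by
  simp [incl_apply]

/-- A set of solutions that is closed under midpoints has a point at which only those inequalities
are tight that are tight on the whole set. -/
theorem exists_relint {F : Set (Ambient M)} (hF : F.Nonempty)
    (hconv : ∀ x ∈ F, ∀ y ∈ F, (2⁻¹ : ℝ) • x + (2⁻¹ : ℝ) • y ∈ F)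
    (s : Finset ((Ambient M →ₗ[ℝ] ℝ) × ℝ)) (hs : F ⊆ solutionSet s) :
    ∃ x ∈ F, ∀ c ∈ s, c.1 x = c.2 → ∀ y ∈ F, c.1 y = c.2 := by
  classical
  induction s using Finset.induction_on with
  | empty => obtain ⟨x, hx⟩ := hF; exact ⟨x, hx, by simp⟩
  | insert c s _ ih =>
    obtain ⟨x, hx, h⟩ := ih fun v hv d hd => hs hv d (Finset.mem_insert_of_mem hd)
    by_cases hc : ∀ y ∈ F, c.1 y = c.2
    · refine ⟨x, hx, fun d hd => ?_⟩
      rcases Finset.mem_insert.1 hd with rfl | hd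
      · exact fun _ => hc
      · exact h d hd
    · push Not at hc
      obtain ⟨y, hy, hcy⟩ := hc
      -- An inequality tight at the midpoint is tight at both endpoints, so `c` becomes slack and
      -- nothing new becomes tight.
      refine ⟨_, hconv x hx y hy, fun d hd hdt => ?_⟩
      have h1 := hs hx d hd
      have h2 := hs hy d hd
      simp only [map_add, map_smul, smul_eq_mul] at hdt
      have h3 : d.1 x = d.2 := by linarith
      have h4 : d.1 y = d.2 := by linarith
      rcases Finset.mem_insert.1 hd with rfl | hd
      · exact absurd h4 hcy
      · exact h d hd h3

/-- From a solution one can move a little in any direction along which no tight inequality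
increases. -/
theorem exists_pos_add_smul_mem (s : Finset ((Ambient M →ₗ[ℝ] ℝ) × ℝ)) {x d : Ambient M}
    (hx : x ∈ solutionSet s) (hd : ∀ c ∈ s, c.1 x = c.2 → c.1 d ≤ 0) :
    ∃ ε : ℝ, 0 < ε ∧ x + ε • d ∈ solutionSet s := by
  classical
  have key : ∃ ε : ℝ, 0 < ε ∧ ∀ c ∈ s, ∀ δ, 0 ≤ δ → δ ≤ ε → c.1 x + δ * c.1 d ≤ c.2 := by
    induction s using Finset.induction_on with
    | empty => exact ⟨1, one_pos, by simp⟩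
    | insert c s _ ih =>
      obtain ⟨ε, hε, h⟩ := ih (fun e he => hx e (Finset.mem_insert_of_mem he))
        (fun e he => hd e (Finset.mem_insert_of_mem he))
      have hc : ∃ η : ℝ, 0 < η ∧ ∀ δ, 0 ≤ δ → δ ≤ η → c.1 x + δ * c.1 d ≤ c.2 := by
        have hcx := hx c (Finset.mem_insert_self _ _)
        rcases le_or_gt (c.1 d) 0 with h0 | h0
        · exact ⟨1, one_pos, fun δ hδ _ => by nlinarith⟩
        · have hlt : c.1 x < c.2 := lt_of_le_of_ne hcx fun he =>
            absurd (hd c (Finset.mem_insert_self _ _) he) (not_le.2 h0)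
          refine ⟨(c.2 - c.1 x) / c.1 d, div_pos (sub_pos.2 hlt) h0, fun δ _ hδ => ?_⟩
          rw [le_div_iff₀ h0] at hδ
          linarith
      obtain ⟨η, hη, h'⟩ := hc
      refine ⟨min ε η, lt_min hε hη, fun e he δ h0 h1 => ?_⟩
      rcases Finset.mem_insert.1 he with rfl | he
      · exact h' δ h0 (h1.trans (min_le_right _ _))
      · exact h e he δ h0 (h1.trans (min_le_left _ _))
  obtain ⟨ε, hε, h⟩ := key
  exact ⟨ε, hε, fun c hc => by simpa using h c hc ε hε.le le_rfl⟩

/-- Each functional in `I` is bounded by its right-hand side, so their sum reaches the sum of the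
bounds only where all of them are tight. -/
theorem isFace_tightSet {s I : Finset ((Ambient M →ₗ[ℝ] ℝ) × ℝ)} (hI : I ⊆ s)
    (h : (tightSet s I).Nonempty) : IsFace (tightSet s I) (solutionSet s) := by
  refine ⟨h, ∑ c ∈ I, c.1, ?_⟩
  obtain ⟨x, hx, hxI⟩ := h
  ext v
  simp only [tightSet, Set.mem_ofPred_eq, LinearMap.sum_apply]
  refine and_congr_right fun hv => ⟨fun ht y hy => ?_, fun hmax => ?_⟩
  · exact Finset.sum_le_sum fun c hc => (hy c (hI hc)).trans (ht c hc).ge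
  · have hle : ∀ c ∈ I, c.1 v ≤ c.2 := fun c hc => hv c (hI hc)
    refine (Finset.sum_eq_sum_iff_of_le hle).1 (le_antisymm (Finset.sum_le_sum hle) ?_)
    rw [← Finset.sum_congr rfl hxI]
    exact hmax x hx

/-- The faces of a polyhedron are obtained by making some of the inequalities tight. -/
theorem IsFace.exists_tightSet {s : Finset ((Ambient M →ₗ[ℝ] ℝ) × ℝ)} {F : Set (Ambient M)}
    (h : IsFace F (solutionSet s)) : ∃ I ⊆ s, F = tightSet s I := by
  classical
  obtain ⟨hne, p, hp⟩ := h
  have hsub : F ⊆ solutionSet s := fun v hv => by rw [hp] at hv; exact hv.1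
  have hconv : ∀ x ∈ F, ∀ y ∈ F, (2⁻¹ : ℝ) • x + (2⁻¹ : ℝ) • y ∈ F := by
    intro x hx y hy
    have hx' := hx
    have hy' := hy
    rw [hp] at hx' hy' ⊢
    refine ⟨fun c hc => ?_, fun z hz => ?_⟩
    · have h1 := hx'.1 c hc
      have h2 := hy'.1 c hc
      simp only [map_add, map_smul, smul_eq_mul]
      linarith
    · have h1 := hx'.2 z hz
      have h2 := hy'.2 z hz
      simp only [map_add, map_smul, smul_eq_mul]
      linarith
  obtain ⟨x, hx, hxs⟩ := exists_relint hne hconv s hsub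
  refine ⟨s.filter fun c => c.1 x = c.2, Finset.filter_subset _ _, ?_⟩
  ext v
  refine ⟨fun hv => ⟨hsub hv, fun c hc => ?_⟩, fun hv => ?_⟩
  · rw [Finset.mem_filter] at hc
    exact hxs c hc.1 hc.2 v hv
  -- The segment from `v` to `x` extends slightly beyond `x` inside the polyhedron; since `p` is
  -- maximal at `x`, it cannot be smaller at `v`.
  · have hd : ∀ c ∈ s, c.1 x = c.2 → c.1 (x - v) ≤ 0 := fun c hc hcx => by
      rw [map_sub, hcx, hv.2 c (Finset.mem_filter.2 ⟨hc, hcx⟩), sub_self]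
    obtain ⟨ε, hε, hmem⟩ := exists_pos_add_smul_mem s (hsub hx) hd
    rw [hp] at hx ⊢
    have h1 := hx.2 _ hmem
    simp only [map_add, map_smul, map_sub, smul_eq_mul] at h1
    have h2 : p x ≤ p v := by
      by_contra hlt
      have := mul_pos hε (sub_pos.2 (not_le.1 hlt))
      linarith
    exact ⟨hv.1, fun y hy => (hx.2 y hy).trans h2⟩

open Classical in
/-- The tight set as the solution set of a larger system. -/
theorem tightSet_eq_solutionSet {s I : Finset ((Ambient M →ₗ[ℝ] ℝ) × ℝ)} :
    tightSet s I = solutionSet (s ∪ (I ∪ I.image fun c => -c)) := by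
  ext v
  simp only [tightSet, solutionSet, Set.mem_ofPred_eq, Finset.mem_union, or_imp, forall_and,
    Finset.forall_mem_image, Prod.fst_neg, Prod.snd_neg, LinearMap.neg_apply, neg_le_neg_iff]
  refine and_congr_right fun _ => ?_
  rw [← forall_and]
  exact ⟨fun h c => ⟨fun hc => (h c hc).le, fun hc => (h c hc).ge⟩,
    fun h c hc => le_antisymm ((h c).1 hc) ((h c).2 hc)⟩

theorem IsFace.trans {P F G : Set (Ambient M)} (hP : IsPolyhedron P) (hF : IsFace F P)
    (hG : IsFace G F) : IsFace G P := by
  classical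
  obtain ⟨s, rfl⟩ := hP
  change IsFace F (solutionSet s) at hF
  change IsFace G (solutionSet s)
  obtain ⟨I, hI, rfl⟩ := hF.exists_tightSet
  rw [tightSet_eq_solutionSet] at hG
  have hne := hG.1
  obtain ⟨J, hJ, rfl⟩ := hG.exists_tightSet
  -- Members of `J` outside `s` are negatives of members of `I`, so they are already tight.
  have heq : tightSet (s ∪ (I ∪ I.image fun c => -c)) J = tightSet s (I ∪ J.filter (· ∈ s)) := by
    ext v
    change v ∈ solutionSet _ ∧ _ ↔ _
    rw [← tightSet_eq_solutionSet]
    simp only [tightSet, Set.mem_ofPred_eq, Finset.mem_union, Finset.mem_filter, and_assoc]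
    refine and_congr_right fun _ => ⟨fun h c hc => ?_, fun h => ⟨fun c hc => h c (.inl hc), ?_⟩⟩
    · rcases hc with hc | hc
      · exact h.1 c hc
      · exact h.2 c hc.1
    · intro c hc
      by_cases hcs : c ∈ s
      · exact h c (.inr ⟨hc, hcs⟩)
      · have := hJ hc
        simp only [Finset.mem_union, hcs, false_or, Finset.mem_image] at this
        rcases this with hcI | ⟨d, hd, rfl⟩
        · exact absurd (hI hcI) hcs
        · have := h d (.inl hd)
          simp [this]
  rw [heq] at hne ⊢
  exact isFace_tightSet (Finset.union_subset hI fun c hc => (Finset.mem_filter.1 hc).2) hne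

theorem IsFace.isRationalPolyhedron {P F : Set (Ambient M)} (hP : IsRationalPolyhedron P)
    (hF : IsFace F P) : IsRationalPolyhedron F := by
  classical
  obtain ⟨t, ht, rfl⟩ := hP.exists_solutionSet
  obtain ⟨I, hI, rfl⟩ := hF.exists_tightSet
  rw [tightSet_eq_solutionSet]
  refine isRationalPolyhedron_solutionSet fun c hc => ?_
  simp only [Finset.mem_union, Finset.mem_image] at hc
  rcases hc with hc | hc | ⟨d, hd, rfl⟩
  · exact ht c hc
  · exact ht c (hI hc)
  · obtain ⟨e, rfl⟩ := ht d (hI hd)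
    exact ⟨-e, by simp [realConstraint, extendFunctional_neg]⟩

/-- A point at which a maximal set of inequalities is tight lies in a minimal face, which is an
affine subspace. -/
theorem exists_affine_minimal_face (s I : Finset ((Ambient M →ₗ[ℝ] ℝ) × ℝ)) (hI : I ⊆ s)
    (hne : (tightSet s I).Nonempty) :
    ∃ x ∈ tightSet s I, ∀ y, (∀ c ∈ s, c.1 x = c.2 → c.1 y = c.2) → y ∈ tightSet s I := by
  classical
  let active : Ambient M → Finset ((Ambient M →ₗ[ℝ] ℝ) × ℝ) := fun v => s.filter fun c => c.1 v = c.2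
  have hfin : (active '' tightSet s I).Finite :=
    (s.powerset.finite_toSet).subset (by
      rintro _ ⟨v, -, rfl⟩
      exact Finset.mem_powerset.2 (Finset.filter_subset _ _))
  obtain ⟨A, hA⟩ := hfin.exists_maximal (hne.image _)
  obtain ⟨⟨x, hx, rfl⟩, hmax⟩ := hA
  have hmem : ∀ z, z ∈ solutionSet s → (∀ c ∈ s, c.1 x = c.2 → c.1 z = c.2) →
      z ∈ tightSet s I := fun z hz h => ⟨hz, fun c hc => h c (hI hc) (hx.2 c hc)⟩
  refine ⟨x, hx, fun y hy => hmem y (by_contra fun hyP => ?_) hy⟩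
  let bad := s.filter fun c => c.2 < c.1 y
  have hbad : bad.Nonempty := by
    simp only [solutionSet, Set.mem_ofPred_eq, not_forall, not_le] at hyP
    obtain ⟨c, hc, h⟩ := hyP
    exact ⟨c, Finset.mem_filter.2 ⟨hc, h⟩⟩
  -- Time at which the segment from `x` to `y` meets the hyperplane of `c`. At the first such time
  -- the point is still feasible, keeps all equalities of `x` and gains `c₀`, against maximality.
  let τ : (Ambient M →ₗ[ℝ] ℝ) × ℝ → ℝ := fun c => (c.2 - c.1 x) / (c.1 y - c.1 x)
  have hslack : ∀ c ∈ bad, c.1 x < c.2 := fun c hc => by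
    have hc := Finset.mem_filter.1 hc
    exact lt_of_le_of_ne (hx.1 c hc.1) fun he => hc.2.ne' (hy c hc.1 he)
  obtain ⟨c₀, hc₀, hmin⟩ := bad.exists_min_image τ hbad
  have hc₀' := Finset.mem_filter.1 hc₀
  have hden : ∀ c ∈ bad, 0 < c.1 y - c.1 x := fun c hc => by
    have := hslack c hc
    have := (Finset.mem_filter.1 hc).2
    linarith
  have hτ0 : 0 < τ c₀ := div_pos (sub_pos.2 (hslack c₀ hc₀)) (hden c₀ hc₀)
  have hτ1 : τ c₀ ≤ 1 := by
    rw [div_le_one (hden c₀ hc₀)]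
    linarith [hc₀'.2]
  have hz : ∀ c : (Ambient M →ₗ[ℝ] ℝ) × ℝ,
      c.1 (x + τ c₀ • (y - x)) = c.1 x + τ c₀ * (c.1 y - c.1 x) := fun c => by simp
  have hzmem : x + τ c₀ • (y - x) ∈ tightSet s I := by
    refine hmem _ (fun c hc => ?_) fun c hc hcx => ?_
    · rw [hz]
      by_cases hcb : c ∈ bad
      · have := hmin c hcb
        rw [le_div_iff₀ (hden c hcb)] at this
        linarith
      · have h1 := hx.1 c hc
        have h2 : c.1 y ≤ c.2 := not_lt.1 fun h => hcb (Finset.mem_filter.2 ⟨hc, h⟩)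
        nlinarith [mul_nonneg hτ0.le (sub_nonneg.2 h2),
          mul_nonneg (sub_nonneg.2 hτ1) (sub_nonneg.2 h1)]
    · rw [hz, hy c hc hcx, hcx, sub_self, mul_zero, add_zero]
  have hle : active x ≤ active (x + τ c₀ • (y - x)) := fun c hc => by
    have hc := Finset.mem_filter.1 hc
    refine Finset.mem_filter.2 ⟨hc.1, ?_⟩
    rw [hz, hy c hc.1 hc.2, hc.2, sub_self, mul_zero, add_zero]
  have hc₀z : c₀ ∈ active (x + τ c₀ • (y - x)) := by
    refine Finset.mem_filter.2 ⟨hc₀'.1, ?_⟩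
    rw [hz, div_mul_cancel₀ _ (hden c₀ hc₀).ne']
    ring
  have := hmax ⟨_, hzmem, rfl⟩ hle hc₀z
  exact (hslack c₀ hc₀).ne (Finset.mem_filter.1 this).2

theorem sub_mem_tangentSpace {F : Set (Ambient M)} {x y : Ambient M} (hx : x ∈ F) (hy : y ∈ F) :
    x - y ∈ tangentSpace F :=
  Submodule.subset_span (Set.sub_mem_sub hx hy)

theorem apply_eq_zero_of_mem_tangentSpace {F : Set (Ambient M)} {p : Ambient M →ₗ[ℝ] ℝ} {a : ℝ}
    (h : ∀ x ∈ F, p x = a) {d : Ambient M} (hd : d ∈ tangentSpace F) : p d = 0 := by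
  have : tangentSpace F ≤ LinearMap.ker p := by
    refine Submodule.span_le.2 ?_
    rintro _ ⟨x, hx, y, hy, rfl⟩
    simp [h x hx, h y hy]
  exact this hd

end Systems

/-! ### Translations, reflection and ampleness -/

section Symmetries

variable {M : Type*} [AddCommGroup M]

theorem image_add_right_eq (P : Set (Ambient M)) (w : Ambient M) :
    (fun v => v + w) '' P = {v | v - w ∈ P} := by
  ext v
  exact ⟨by rintro ⟨x, hx, rfl⟩; simpa using hx, fun h => ⟨v - w, h, by simp⟩⟩

/-- The functional is pulled back along the linear part; the translation adds the same constant to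
both sides. This covers translations and the reflection at once. -/
theorem IsFace.preimage_equiv {P F : Set (Ambient M)} (e : Ambient M ≃ Ambient M)
    (l : Ambient M →ₗ[ℝ] Ambient M) (w : Ambient M) (he : ∀ v, e v = l v + w)
    (h : IsFace F (e '' P)) : IsFace (e ⁻¹' F) P := by
  obtain ⟨⟨x, hx⟩, p, rfl⟩ := h
  refine ⟨⟨e.symm x, by simpa using hx⟩, p ∘ₗ l, ?_⟩
  ext v
  have hmem : e v ∈ e '' P ↔ v ∈ P := e.injective.mem_set_image
  simp only [Set.mem_preimage, Set.mem_ofPred_eq, hmem, Set.forall_mem_image]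
  simp only [he, map_add, LinearMap.comp_apply, add_le_add_iff_right]

theorem tangentSpace_image_add (F : Set (Ambient M)) (w : Ambient M) :
    tangentSpace ((fun v => v + w) '' F) = tangentSpace F := by
  unfold tangentSpace
  congr 1
  ext d
  constructor
  · rintro ⟨_, ⟨x, hx, rfl⟩, _, ⟨y, hy, rfl⟩, rfl⟩
    exact ⟨x, hx, y, hy, (add_sub_add_right_eq_sub x y w).symm⟩
  · rintro ⟨x, hx, y, hy, rfl⟩
    exact ⟨_, ⟨x, hx, rfl⟩, _, ⟨y, hy, rfl⟩, add_sub_add_right_eq_sub x y w⟩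

theorem tangentSpace_neg (F : Set (Ambient M)) : tangentSpace (-F) = tangentSpace F := by
  unfold tangentSpace
  congr 1
  ext d
  constructor
  · rintro ⟨x, hx, y, hy, rfl⟩
    exact ⟨-y, hy, -x, hx, neg_sub_neg y x⟩
  · rintro ⟨x, hx, y, hy, rfl⟩
    exact ⟨-y, by simpa using hy, -x, by simpa using hx, neg_sub_neg y x⟩

theorem IsRationalPolyhedron.translate {P : Set (Ambient M)} (h : IsRationalPolyhedron P)
    (m : M) : IsRationalPolyhedron ((fun v => v + incl M m) '' P) := by
  classical
  obtain ⟨s, rfl⟩ := h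
  refine ⟨s.image fun c => (c.1, c.2 + c.1 m), ?_⟩
  rw [image_add_right_eq]
  ext v
  simp only [Set.mem_ofPred_eq, Finset.forall_mem_image, map_sub, extendFunctional_incl,
    sub_le_iff_le_add, Int.cast_add]

theorem IsRationalPolyhedron.neg {P : Set (Ambient M)} (h : IsRationalPolyhedron P) :
    IsRationalPolyhedron (-P) := by
  classical
  obtain ⟨s, rfl⟩ := h
  refine ⟨s.image fun c => (-c.1, c.2), ?_⟩
  ext v
  simp only [Set.mem_ofPred_eq, Set.mem_neg, Finset.forall_mem_image, map_neg,
    extendFunctional_neg, LinearMap.neg_apply]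

theorem IsIntegerPoint.add {v w : Ambient M} (hv : IsIntegerPoint v) (hw : IsIntegerPoint w) :
    IsIntegerPoint (v + w) := by
  obtain ⟨m, rfl⟩ := hv
  obtain ⟨n, rfl⟩ := hw
  exact ⟨m + n, map_add _ _ _⟩

theorem IsIntegerPoint.neg {v : Ambient M} (hv : IsIntegerPoint v) : IsIntegerPoint (-v) := by
  obtain ⟨m, rfl⟩ := hv
  exact ⟨-m, map_neg _ _⟩

theorem mem_phInt_iff {U : Set (Submodule ℝ (Ambient M))} {P : Set (Ambient M)} :
    P ∈ PhInt U ↔ IsRationalPolyhedron P ∧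
      ∀ F, IsFace F P → tangentSpace F ∈ U ∧ ∃ v ∈ F, IsIntegerPoint v :=
  ⟨fun h => ⟨h.2.1, fun F hF => ⟨h.1.2 F hF, h.2.2 F hF⟩⟩,
    fun h => ⟨⟨h.1.isPolyhedron, fun F hF => (h.2 F hF).1⟩, h.1, fun F hF => (h.2 F hF).2⟩⟩

theorem isAmple_phInt (U : Set (Submodule ℝ (Ambient M))) : IsAmple (PhInt U) where
  integer P hP := hP.2
  translate P hP m := by
    rw [mem_phInt_iff] at hP ⊢
    refine ⟨hP.1.translate m, fun F hF => ?_⟩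
    have hF' := IsFace.preimage_equiv (Equiv.addRight (incl M m)) LinearMap.id (incl M m)
      (fun v => rfl) hF
    obtain ⟨hT, v, hv, hvi⟩ := hP.2 _ hF'
    refine ⟨?_, _, hv, hvi.add ⟨m, rfl⟩⟩
    rwa [← tangentSpace_image_add _ (incl M m),
      show (fun v => v + incl M m) '' (Equiv.addRight (incl M m) ⁻¹' F) = F from
        Set.image_preimage_eq _ (Equiv.addRight (incl M m)).surjective] at hT
  reflect P hP := by
    rw [mem_phInt_iff] at hP ⊢
    refine ⟨hP.1.neg, fun F hF => ?_⟩
    rw [← Set.image_neg_eq_neg] at hF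
    have hF' : IsFace (-F) P := IsFace.preimage_equiv (Equiv.neg _) (-LinearMap.id) 0
      (fun v => by simp) hF
    obtain ⟨hT, v, hv, hvi⟩ := hP.2 _ hF'
    exact ⟨by rwa [tangentSpace_neg] at hT, _, hv, hvi.neg⟩
  face P hP F hF := by
    rw [mem_phInt_iff] at hP ⊢
    exact ⟨hF.isRationalPolyhedron hP.1, fun G hG => hP.2 G (hF.trans hP.1.isPolyhedron hG)⟩

end Symmetries

/-! ### Rational subspaces, purity and the two implications -/

section Subspaces

variable {M : Type*} [AddCommGroup M]

theorem mem_integerPoints {L : Submodule ℝ (Ambient M)} {m : M} :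
    m ∈ integerPoints L ↔ incl M m ∈ L := Iff.rfl

theorem IsRationalSubspace.le {L N : Submodule ℝ (Ambient M)} (hL : IsRationalSubspace L)
    (h : integerPoints L ≤ integerPoints N) : L ≤ N := by
  rw [← hL, Submodule.span_le]
  rintro _ ⟨hv, m, rfl⟩
  exact h hv

theorem IsRationalSubspace.sup {L N : Submodule ℝ (Ambient M)} (hL : IsRationalSubspace L)
    (hN : IsRationalSubspace N) : IsRationalSubspace (L ⊔ N) := by
  refine le_antisymm (Submodule.span_le.2 fun v hv => hv.1) (sup_le ?_ ?_)
  · conv_lhs => rw [← hL]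
    exact Submodule.span_mono fun v hv => ⟨le_sup_left (a := L) hv.1, hv.2⟩
  · conv_lhs => rw [← hN]
    exact Submodule.span_mono fun v hv => ⟨le_sup_right (b := N) hv.1, hv.2⟩

/-- The group of integer points of a subspace is the kernel of a projection of `M`. -/
theorem exists_projection [Module.Free ℤ M] [Module.Finite ℤ M] (L : Submodule ℝ (Ambient M)) :
    ∃ π : M →ₗ[ℤ] M, (∀ m, m - π m ∈ integerPoints L) ∧ ∀ m ∈ integerPoints L, π m = 0 := by
  let S : Submodule ℤ M := AddSubgroup.toIntSubmodule (integerPoints L)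
  have hS : ∀ m, m ∈ S ↔ incl M m ∈ L := fun m => Iff.rfl
  -- Nonzero integers can be divided out in `L`, so the quotient is torsion-free, hence free, and
  -- its projection has a section `σ`.
  have htf : Module.IsTorsionFree ℤ (M ⧸ S) := by
    refine Module.IsTorsionFree.mk fun k hk a b hab => ?_
    have hk0 : k ≠ 0 := hk.ne_zero
    obtain ⟨a, rfl⟩ := S.mkQ_surjective a
    obtain ⟨b, rfl⟩ := S.mkQ_surjective b
    simp only [← map_smul] at hab
    rw [Submodule.mkQ_apply, Submodule.mkQ_apply, Submodule.Quotient.eq, ← smul_sub, hS, map_zsmul,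
      ← Int.cast_smul_eq_zsmul ℝ] at hab
    rw [Submodule.mkQ_apply, Submodule.mkQ_apply, Submodule.Quotient.eq, hS]
    exact (L.smul_mem_iff (Int.cast_ne_zero.2 hk0)).1 hab
  have : Module.Free ℤ (M ⧸ S) := inferInstance
  obtain ⟨σ, hσ⟩ := Module.projective_lifting_property S.mkQ LinearMap.id S.mkQ_surjective
  refine ⟨σ ∘ₗ S.mkQ, fun m => ?_, fun m hm => ?_⟩
  · change m - σ (S.mkQ m) ∈ S
    rw [← Submodule.Quotient.mk_eq_zero, ← Submodule.mkQ_apply, map_sub, sub_eq_zero]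
    exact (LinearMap.congr_fun hσ (S.mkQ m)).symm
  · have : S.mkQ m = 0 := (Submodule.Quotient.mk_eq_zero S).2 hm
    rw [LinearMap.comp_apply, this, map_zero]

/-- A rational subspace is cut out by finitely many integer functionals. -/
theorem IsRationalSubspace.exists_functionals [Module.Free ℤ M] [Module.Finite ℤ M]
    {L : Submodule ℝ (Ambient M)} (hL : IsRationalSubspace L) :
    ∃ s : Finset (M →ₗ[ℤ] ℤ), ∀ v, v ∈ L ↔ ∀ p ∈ s, extendFunctional p v = 0 := by
  classical
  obtain ⟨π, hπ, hπ0⟩ := exists_projection L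
  let b := Module.Free.chooseBasis ℤ M
  have hcoord : ∀ i v, extendFunctional (b.coord i ∘ₗ π) v =
      (b.baseChange ℝ).repr (π.baseChange ℝ v) i := by
    intro i v
    induction v using TensorProduct.induction_on with
    | zero => simp
    | tmul r m => simp [Module.Basis.baseChange_repr_tmul]
    | add x y hx hy => simp only [map_add, hx, hy, Finsupp.add_apply]
  -- The coordinates of `π` serve as functionals: their common real kernel is that of the extended
  -- `π`, which equals `L`.
  refine ⟨Finset.univ.image fun i => b.coord i ∘ₗ π, fun v => ?_⟩
  have hker : (∀ p ∈ Finset.univ.image fun i => b.coord i ∘ₗ π, extendFunctional p v = 0) ↔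
      π.baseChange ℝ v = 0 := by
    simp only [Finset.forall_mem_image, Finset.mem_univ, true_implies, hcoord]
    rw [← (b.baseChange ℝ).repr.map_eq_zero_iff]
    exact ⟨fun h => Finsupp.ext @h, fun h i => by rw [h]; rfl⟩
  rw [hker]
  constructor
  · intro hv
    have : L ≤ LinearMap.ker (π.baseChange ℝ) := by
      conv_lhs => rw [← hL]
      rw [Submodule.span_le]
      rintro _ ⟨hm, m, rfl⟩
      have := hπ0 m hm
      simp [incl_apply, this]
    exact this hv
  · intro hv
    have hsub : ∀ w, w - π.baseChange ℝ w ∈ L := by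
      intro w
      induction w using TensorProduct.induction_on with
      | zero => simp
      | tmul r m =>
        have := L.smul_mem r (mem_integerPoints.1 (hπ m))
        rw [incl_apply, TensorProduct.smul_tmul', smul_eq_mul, mul_one,
          TensorProduct.tmul_sub] at this
        simpa using this
      | add x y hx hy =>
        rw [map_add, add_sub_add_comm]
        exact L.add_mem hx hy
    simpa [hv] using hsub v

theorem IsRationalSubspace.isRationalPolyhedron [Module.Free ℤ M] [Module.Finite ℤ M]
    {L : Submodule ℝ (Ambient M)} (hL : IsRationalSubspace L) :
    IsRationalPolyhedron (L : Set (Ambient M)) := by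
  classical
  obtain ⟨s, hs⟩ := hL.exists_functionals
  refine ⟨s.image (fun p => (p, 0)) ∪ s.image (fun p => (-p, 0)), ?_⟩
  ext v
  simp only [SetLike.mem_coe, hs, Set.mem_ofPred_eq, Finset.mem_union, or_imp, forall_and,
    Finset.forall_mem_image, extendFunctional_neg, LinearMap.neg_apply, Int.cast_zero,
    neg_nonpos]
  exact ⟨fun h => ⟨fun p hp => (h p hp).le, fun p hp => (h p hp).ge⟩,
    fun h p hp => le_antisymm (h.1 hp) (h.2 hp)⟩

/-- A functional bounded above on a subspace vanishes on it. -/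
theorem eq_of_isFace_submodule {L : Submodule ℝ (Ambient M)} {F : Set (Ambient M)}
    (h : IsFace F (L : Set (Ambient M))) : F = L := by
  obtain ⟨⟨x, hx⟩, p, rfl⟩ := h
  have h0 : ∀ y ∈ L, p y ≤ 0 := fun y hy => by
    have := hx.2 (x + y) (L.add_mem hx.1 hy)
    rw [map_add] at this
    linarith
  ext v
  refine ⟨fun hv => hv.1, fun hv => ⟨hv, fun y hy => ?_⟩⟩
  have h1 := h0 y hy
  have h2 := h0 (-v) (L.neg_mem hv)
  rw [map_neg] at h2
  linarith

theorem tangentSpace_submodule (L : Submodule ℝ (Ambient M)) :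
    tangentSpace (L : Set (Ambient M)) = L := by
  refine le_antisymm (Submodule.span_le.2 ?_) fun v hv => ?_
  · rintro _ ⟨x, hx, y, hy, rfl⟩
    exact L.sub_mem hx hy
  · simpa using sub_mem_tangentSpace (F := (L : Set (Ambient M))) hv L.zero_mem

theorem submodule_mem_phInt [Module.Free ℤ M] [Module.Finite ℤ M]
    {U : Set (Submodule ℝ (Ambient M))} {L : Submodule ℝ (Ambient M)} (hLU : L ∈ U)
    (hL : IsRationalSubspace L) : (L : Set (Ambient M)) ∈ PhInt U := by
  refine mem_phInt_iff.2 ⟨hL.isRationalPolyhedron, fun F hF => ?_⟩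
  rw [eq_of_isFace_submodule hF, tangentSpace_submodule]
  exact ⟨hLU, 0, L.zero_mem, 0, map_zero _⟩

theorem IsIntegerPolyhedron.exists_isIntegerPoint {P : Set (Ambient M)}
    (h : IsIntegerPolyhedron P) (hne : P.Nonempty) : ∃ v ∈ P, IsIntegerPoint v :=
  h.2 P ⟨hne, 0, by ext; simp⟩

theorem integerPoints_sup_le (L N : Submodule ℝ (Ambient M)) :
    integerPoints L ⊔ integerPoints N ≤ integerPoints (L ⊔ N) :=
  sup_le (fun _ hm => Submodule.mem_sup_left hm) fun _ hm => Submodule.mem_sup_right hm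

/-- For rational subspaces, mutual purity says that the integer points of the sum are sums of
integer points. -/
theorem mutuallyPure_iff {L N : Submodule ℝ (Ambient M)} (hL : IsRationalSubspace L)
    (hN : IsRationalSubspace N) :
    MutuallyPure L N ↔ integerPoints (L ⊔ N) ≤ integerPoints L ⊔ integerPoints N := by
  refine ⟨fun ⟨K, _, h⟩ => ?_, fun h => ⟨_, hL.sup hN, le_antisymm h (integerPoints_sup_le L N)⟩⟩
  rw [← h]
  -- By rationality, a subspace containing the integer points of `L` and `N` contains `L ⊔ N`.
  exact fun m hm => sup_le (hL.le (h ▸ le_sup_left)) (hN.le (h ▸ le_sup_right)) hm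

theorem isPureSystem_of_isDCClass [Module.Free ℤ M] [Module.Finite ℤ M]
    {U : Set (Submodule ℝ (Ambient M))} (hU : ∀ L ∈ U, IsRationalSubspace L)
    (h : IsDCClass (PhInt U)) : IsPureSystem U := by
  intro L hL N hN
  refine (mutuallyPure_iff (hU L hL) (hU N hN)).2 fun m hm => ?_
  obtain ⟨l, hl, n, hn, hln⟩ := Submodule.mem_sup.1 (mem_integerPoints.1 hm)
  have hint := h.edmonds _ (submodule_mem_phInt hL (hU L hL)) _
    (h.ample.translate _ (submodule_mem_phInt hN (hU N hN)) m)
  rw [image_add_right_eq] at hint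
  obtain ⟨_, ⟨hzL, hzN⟩, z, rfl⟩ := hint.exists_isIntegerPoint
    ⟨l, hl, by
      change l - incl M m ∈ N
      rw [← hln, sub_add_cancel_left]
      exact N.neg_mem hn⟩
  refine AddSubgroup.mem_sup.2 ⟨z, hzL, m - z, ?_, add_sub_cancel _ _⟩
  rw [mem_integerPoints, map_sub, ← neg_sub]
  exact N.neg_mem hzN

theorem isDCClass_of_isPureSystem {U : Set (Submodule ℝ (Ambient M))}
    (hU : ∀ L ∈ U, IsRationalSubspace L) (h : IsPureSystem U) : IsDCClass (PhInt U) := by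
  classical
  refine ⟨isAmple_phInt U, fun P hP Q hQ => ?_⟩
  rw [mem_phInt_iff] at hP hQ
  refine ⟨hP.1.inter hQ.1, fun H hH => ?_⟩
  obtain ⟨s, -, rfl⟩ := hP.1.exists_solutionSet
  obtain ⟨t, -, rfl⟩ := hQ.1.exists_solutionSet
  have hunion : solutionSet s ∩ solutionSet t = solutionSet (s ∪ t) := by
    ext v
    simp only [solutionSet, Set.mem_inter_iff, Set.mem_ofPred_eq, Finset.mem_union, or_imp,
      forall_and]
  rw [hunion] at hH
  have hne := hH.1
  obtain ⟨I, hI, rfl⟩ := hH.exists_tightSet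
  obtain ⟨x, hx, hmin⟩ := exists_affine_minimal_face _ I hI hne
  have hxst : x ∈ solutionSet s ∩ solutionSet t := hunion ▸ hx.1
  -- Applied to both `s` and `t`: the inequalities tight at `x` stay tight on an affine space
  -- through `x` with an integer point and direction in `U`.
  have key : ∀ u : Finset ((Ambient M →ₗ[ℝ] ℝ) × ℝ), x ∈ solutionSet u →
      (∀ F, IsFace F (solutionSet u) → tangentSpace F ∈ U ∧ ∃ v ∈ F, IsIntegerPoint v) →
      ∃ L ∈ U, ∃ m : M, x - incl M m ∈ L ∧
        ∀ d ∈ L, ∀ c ∈ u, c.1 x = c.2 → c.1 (incl M m + d) = c.2 := by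
    intro u hxu hu
    have hxT : x ∈ tightSet u (u.filter fun c => c.1 x = c.2) :=
      ⟨hxu, fun c hc => (Finset.mem_filter.1 hc).2⟩
    obtain ⟨hT, _, hv, m, rfl⟩ := hu _ (isFace_tightSet (Finset.filter_subset _ _) ⟨x, hxT⟩)
    refine ⟨_, hT, m, sub_mem_tangentSpace hxT hv, fun d hd c hc hcx => ?_⟩
    have hcI : c ∈ u.filter fun c => c.1 x = c.2 := Finset.mem_filter.2 ⟨hc, hcx⟩
    rw [map_add, hv.2 c hcI, apply_eq_zero_of_mem_tangentSpace (fun y hy => hy.2 c hcI) hd,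
      add_zero]
  obtain ⟨L, hL, m, hmL, hmc⟩ := key s hxst.1 hP.2
  obtain ⟨N, hN, n, hnN, hnc⟩ := key t hxst.2 hQ.2
  have hmn : n - m ∈ integerPoints (L ⊔ N) := by
    rw [mem_integerPoints, map_sub, ← sub_sub_sub_cancel_left _ _ x]
    exact Submodule.sub_mem _ (Submodule.mem_sup_left hmL) (Submodule.mem_sup_right hnN)
  obtain ⟨l, hl, k, hk, hlk⟩ := AddSubgroup.mem_sup.1
    ((mutuallyPure_iff (hU L hL) (hU N hN)).1 (h L hL N hN) hmn)
  have hml : m + l = n + -k := by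
    rw [← sub_eq_add_neg, eq_sub_iff_add_eq, add_assoc, hlk, add_sub_cancel]
  refine ⟨incl M (m + l), hmin _ fun c hc hcx => ?_, m + l, rfl⟩
  rcases Finset.mem_union.1 hc with hc | hc
  · rw [map_add]
    exact hmc _ hl c hc hcx
  · rw [hml, map_add]
    exact hnc _ ((integerPoints N).neg_mem hk) c hc hcx

end Subspaces

end DiscreteConvexity

theorem theorem2 {M : Type*} [AddCommGroup M] [Module.Free ℤ M] [Module.Finite ℤ M]
    (U : Set (Submodule ℝ (DiscreteConvexity.Ambient M)))
    (hU : ∀ L ∈ U, DiscreteConvexity.IsRationalSubspace L) :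
    DiscreteConvexity.IsDCClass (DiscreteConvexity.PhInt U) ↔
      DiscreteConvexity.IsPureSystem U :=
  ⟨DiscreteConvexity.isPureSystem_of_isDCClass hU, DiscreteConvexity.isDCClass_of_isPureSystem hU⟩
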